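/- Let $\mathcal H$ be a separable complex Hilbert space. A conjugation on $\mathcal H$ is a conjugate-linear map $C:\mathcal H\to\mathcal H$ with $C^2=I$ and $\langle Cx,Cy\rangle=\langle y,x\rangle$ for all $x,y\in\mathcal H$. A bounded linear operator $T$ on $\mathcal H$ is called complex symmetric if $CTC=T^*$ for some conjugation $C$ on $\mathcal H$; it is called irreducible if the only orthogonal projections commuting with $T$ are $0$ and $I$; and it is called a weighted shift if there are an orthonormal basis $\{e_i\}$ of $\mathcal H$, indexed by the positive integers (unilateral case) or by all integers (bilateral case), and complex numbers $\{w_i\}$ such that $Te_i=w_ie_{i+1}$ for all $i$. Let $T$ be a bounded linear operator on $\mathcal H$ that is complex symmetric and a (unilateral or bilateral) weighted shift. Then for every $\varepsilon>0$ there exists a compact operator $K$ on $\mathcal H$ with $\|K\|<\varepsilon$ such that $T+K$ is complex symmetric and irreducible. -/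

import Mathlib

open scoped ComplexConjugate InnerProductSpace

namespace CSO

section

variable {H : Type*} [NormedAddCommGroup H] [InnerProductSpace ℂ H]

/-- A conjugation: a conjugate-linear map `C` with `C ∘ C = id` and `⟪C x, C y⟫ = ⟪y, x⟫`. -/
structure IsConjugation (C : H →ₗ⋆[ℂ] H) : Prop where
  involutive : ∀ x, C (C x) = x
  inner_map_map : ∀ x y, ⟪C x, C y⟫_ℂ = ⟪y, x⟫_ℂ

/-- Unilateral weighted shift: `T e_i = w_i e_{i+1}` for an orthonormal basis indexed by
`0, 1, 2, …` (the index is shifted by one from `1, 2, 3, …`) and arbitrary complex weights. -/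
def IsUnilateralWeightedShift (T : H →L[ℂ] H) : Prop :=
  ∃ (e : HilbertBasis ℕ ℂ H) (w : ℕ → ℂ), ∀ i, T (e i) = w i • e (i + 1)

/-- Bilateral weighted shift: `T e_i = w_i e_{i+1}` for an orthonormal basis indexed by `ℤ`
and arbitrary complex weights. -/
def IsBilateralWeightedShift (T : H →L[ℂ] H) : Prop :=
  ∃ (e : HilbertBasis ℤ ℂ H) (w : ℤ → ℂ), ∀ i, T (e i) = w i • e (i + 1)

/-- Weighted shift, unilateral or bilateral. -/
def IsWeightedShift (T : H →L[ℂ] H) : Prop :=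
  IsUnilateralWeightedShift T ∨ IsBilateralWeightedShift T

variable [CompleteSpace H]

/-- `T` is complex symmetric if `C T C = T*` for some conjugation `C`. -/
def IsComplexSymmetric (T : H →L[ℂ] H) : Prop :=
  ∃ C : H →ₗ⋆[ℂ] H, IsConjugation C ∧ ∀ x, C (T (C x)) = ContinuousLinearMap.adjoint T x

/-- `T` is irreducible if the only orthogonal projections commuting with `T` are `0` and `1`. -/
def IsIrreducible (T : H →L[ℂ] H) : Prop :=
  ∀ P : H →L[ℂ] H, IsStarProjection P → Commute P T → P = 0 ∨ P = 1

end

end CSO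

/-!
Write `T = A + iB` with `A`, `B` self-adjoint. Complex symmetry of `T` with respect to `C` means
that `A` and `B` commute with `C`, so that they are real symmetric operators in a `C`-fixed
orthonormal basis. A real version of the Weyl–von Neumann theorem perturbs `A` by a small compact
operator into a diagonal operator `A'` with simple eigenvalues and `C`-fixed eigenvectors. A small
multiple of `w ⊗ w`, for a `C`-fixed vector `w` with no vanishing coordinate, perturbs `B` into an
operator `B'` all of whose matrix entries in this eigenbasis are nonzero. A projection commuting
with `A' + iB'` commutes with `A'`, hence is diagonal, and with `B'`, hence has constant diagonal.
-/

namespace CSO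

variable {H : Type*} [NormedAddCommGroup H] [InnerProductSpace ℂ H]

section Conjugation

variable {C : H →ₗ⋆[ℂ] H}

lemma IsConjugation.norm_map (hC : IsConjugation C) (x : H) : ‖C x‖ = ‖x‖ := by
  rw [@norm_eq_sqrt_re_inner ℂ, @norm_eq_sqrt_re_inner ℂ, hC.inner_map_map]

lemma IsConjugation.continuous (hC : IsConjugation C) : Continuous C :=
  (AddMonoidHomClass.isometry_of_norm C hC.norm_map).continuous

lemma IsConjugation.map_real_smul (hC : IsConjugation C) (r : ℝ) (x : H) :
    C (r • x) = r • C x :=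
  _root_.map_real_smul C hC.continuous r x

lemma IsConjugation.inner_map_left (hC : IsConjugation C) (x y : H) :
    ⟪C x, y⟫_ℂ = ⟪C y, x⟫_ℂ := by
  rw [← hC.inner_map_map, hC.involutive]

lemma map_mem_span_of_map_eq {s : Set H} (hs : ∀ y ∈ s, C y = y) {v : H}
    (hv : v ∈ Submodule.span ℂ s) : C v ∈ Submodule.span ℂ s := by
  have h : Submodule.span ℂ s ≤ (Submodule.span ℂ s).comap C :=
    Submodule.span_le.2 fun y hy => by
      simpa only [SetLike.mem_coe, Submodule.mem_comap, hs y hy] using Submodule.subset_span hy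
  exact h hv

variable [CompleteSpace H]

/-- The real star algebra of the operators commuting with `C`, i.e. of the operators whose matrix
in an orthonormal basis of `C`-fixed vectors is real. -/
noncomputable def IsConjugation.realAlgebra (hC : IsConjugation C) :
    StarSubalgebra ℝ (H →L[ℂ] H) where
  carrier := {X | ∀ v, C (X v) = X (C v)}
  mul_mem' {X Y} hX hY v := by
    change C (X (Y v)) = X (Y (C v))
    rw [hX, hY]
  add_mem' {X Y} hX hY v := by
    simp only [add_apply, map_add, hX v, hY v]
  algebraMap_mem' r v := by
    simp only [Algebra.algebraMap_eq_smul_one, smul_apply,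
      one_apply_eq_self, hC.map_real_smul]
  star_mem' {X} hX v := by
    refine ext_inner_right ℂ fun w => ?_
    rw [ContinuousLinearMap.star_eq_adjoint, hC.inner_map_left,
      ContinuousLinearMap.adjoint_inner_right, ← hX, hC.inner_map_left,
      ContinuousLinearMap.adjoint_inner_left]

lemma IsConjugation.mem_realAlgebra (hC : IsConjugation C) {X : H →L[ℂ] H} :
    X ∈ hC.realAlgebra ↔ ∀ v, C (X v) = X (C v) :=
  Iff.rfl

lemma IsConjugation.isClosed_realAlgebra (hC : IsConjugation C) :
    IsClosed (hC.realAlgebra : Set (H →L[ℂ] H)) := by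
  have h : (hC.realAlgebra : Set (H →L[ℂ] H)) = ⋂ v, {X | C (X v) = X (C v)} := by
    ext X
    simp only [SetLike.mem_coe, hC.mem_realAlgebra, Set.mem_iInter, Set.mem_ofPred_eq]
  rw [h]
  exact isClosed_iInter fun v =>
    isClosed_eq (hC.continuous.comp (continuous_eval_const v)) (continuous_eval_const (C v))

lemma IsConjugation.starProjection_mem_realAlgebra (hC : IsConjugation C) (N : Submodule ℂ H)
    [N.HasOrthogonalProjection] (hN : ∀ v ∈ N, C v ∈ N) : N.starProjection ∈ hC.realAlgebra := by
  intro v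
  refine (Submodule.eq_starProjection_of_mem_of_inner_eq_zero
    (hN _ (Submodule.starProjection_apply_mem N v)) fun w hw => ?_).symm
  rw [← map_sub, hC.inner_map_left, ← inner_conj_symm,
    Submodule.starProjection_inner_eq_zero v (C w) (hN w hw), map_zero]

lemma IsConjugation.rankOne_mem_realAlgebra (hC : IsConjugation C) {w : H} (hw : C w = w) :
    InnerProductSpace.rankOne ℂ w w ∈ hC.realAlgebra := by
  intro v
  rw [InnerProductSpace.rankOne_apply, InnerProductSpace.rankOne_apply, map_smulₛₗ, hw,
    inner_conj_symm, ← hC.inner_map_map w v, hw]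

end Conjugation

section Cartesian

variable [CompleteSpace H] {C : H →ₗ⋆[ℂ] H}

open ContinuousLinearMap ComplexStarModule

lemma IsConjugation.realPart_mem_realAlgebra (hC : IsConjugation C) {T : H →L[ℂ] H}
    (hT : ∀ x, C (T (C x)) = adjoint T x) : (ℜ T : H →L[ℂ] H) ∈ hC.realAlgebra := by
  intro v
  have h1 : C (T v) = adjoint T (C v) := by rw [← hT, hC.involutive]
  have h2 : C (adjoint T v) = T (C v) := by rw [← hT, hC.involutive]
  rw [realPart_apply_coe, star_eq_adjoint, smul_apply, hC.map_real_smul, add_apply, map_add, h1, h2,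
    smul_apply, add_apply, add_comm]

lemma IsConjugation.imaginaryPart_mem_realAlgebra (hC : IsConjugation C) {T : H →L[ℂ] H}
    (hT : ∀ x, C (T (C x)) = adjoint T x) : (ℑ T : H →L[ℂ] H) ∈ hC.realAlgebra := by
  intro v
  have h1 : C (T v) = adjoint T (C v) := by rw [← hT, hC.involutive]
  have h2 : C (adjoint T v) = T (C v) := by rw [← hT, hC.involutive]
  rw [imaginaryPart_apply_coe, star_eq_adjoint]
  simp only [smul_apply, hC.map_real_smul, sub_apply, map_smulₛₗ, map_sub, h1, h2, map_neg,
    Complex.conj_I]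
  module

lemma IsConjugation.map_add_I_smul_map (hC : IsConjugation C) {A B : H →L[ℂ] H}
    (hA : IsSelfAdjoint A) (hAC : A ∈ hC.realAlgebra) (hB : IsSelfAdjoint B)
    (hBC : B ∈ hC.realAlgebra) (x : H) :
    C ((A + Complex.I • B) (C x)) = adjoint (A + Complex.I • B) x := by
  rw [← star_eq_adjoint, star_add, star_smul, hA.star_eq, hB.star_eq]
  simp only [add_apply, smul_apply, map_add, map_smulₛₗ, hAC (C x), hBC (C x), hC.involutive,
    RCLike.star_def]

lemma commute_of_commute_add_I_smul {R : Type*} [Ring R] [StarRing R] [Algebra ℂ R]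
    [StarModule ℂ R] {A B D : R} (hA : IsSelfAdjoint A) (hB : IsSelfAdjoint B)
    (hD : IsSelfAdjoint D) (h : Commute D (A + Complex.I • B)) : Commute D A ∧ Commute D B := by
  have hstar : Commute D (A - Complex.I • B) := by
    have := h.star_star
    rw [hD.star_eq, star_add, star_smul, hA.star_eq, hB.star_eq, Complex.star_def, Complex.conj_I,
      neg_smul, ← sub_eq_add_neg] at this
    exact this
  have hA2 : Commute D ((2 : ℂ) • A) := by
    simpa only [add_add_sub_cancel, two_smul] using h.add_right hstar
  have hB2 : Commute D ((2 * Complex.I) • B) := by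
    simpa only [add_sub_sub_cancel, mul_smul, two_smul] using h.sub_right hstar
  exact ⟨(Commute.smul_right_iff₀ two_ne_zero).1 hA2,
    (Commute.smul_right_iff₀ (mul_ne_zero two_ne_zero Complex.I_ne_zero)).1 hB2⟩

end Cartesian

section Idempotents

variable {R ι κ : Type*} [Ring R] [Fintype ι] [Fintype κ] {E : ι → R} {F : κ → R}

lemma completeOrthogonalIdempotents_mul (hE : CompleteOrthogonalIdempotents E)
    (hF : CompleteOrthogonalIdempotents F) (hEF : ∀ k l, Commute (E k) (F l)) :
    CompleteOrthogonalIdempotents fun p : ι × κ => E p.1 * F p.2 := by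
  refine CompleteOrthogonalIdempotents.iff_ortho_complete.2 ⟨?_, ?_⟩
  · rintro ⟨k, l⟩ ⟨k', l'⟩ hne
    have hmul : E k * F l * (E k' * F l') = E k * E k' * (F l * F l') :=
      (hEF k' l).symm.mul_mul_mul_comm (E k) (F l')
    by_cases hk : k = k'
    · have hl : l ≠ l' := fun hl => hne (Prod.ext hk hl)
      simp only [hmul, hF.ortho hl, mul_zero]
    · simp only [hmul, hE.ortho hk, zero_mul]
  · rw [Fintype.sum_prod_type]
    simp only [← Finset.mul_sum, hF.complete, mul_one, hE.complete]

lemma sum_add_smul_mul [Algebra ℝ R] (hE : CompleteOrthogonalIdempotents E)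
    (hF : CompleteOrthogonalIdempotents F) (t : ι → ℝ) (u : κ → ℝ) :
    ∑ p : ι × κ, (t p.1 + u p.2) • (E p.1 * F p.2) = ∑ k, t k • E k + ∑ l, u l • F l := by
  have ht : ∑ k, ∑ l, t k • (E k * F l) = ∑ k, t k • E k := by
    simp only [← Finset.smul_sum, ← Finset.mul_sum, hF.complete, mul_one]
  have hu : ∑ k, ∑ l, u l • (E k * F l) = ∑ l, u l • F l := by
    rw [Finset.sum_comm]
    simp only [← Finset.smul_sum, ← Finset.sum_mul, hE.complete, one_mul]
  rw [Fintype.sum_prod_type]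
  simp only [add_smul, Finset.sum_add_distrib, ht, hu]

lemma sum_smul_mul_of_orthogonalIdempotents [Algebra ℝ R]
    (hE : OrthogonalIdempotents E) (t : ι → ℝ) (l : ι) :
    (∑ k, t k • E k) * E l = t l • E l := by
  classical
  simp only [Finset.sum_mul, smul_mul_assoc, hE.mul_eq, smul_ite, smul_zero,
    Finset.sum_ite_eq', Finset.mem_univ, if_true]

end Idempotents

section Spectral

open ContinuousLinearMap

lemma commute_starProjection_iff {X : H →L[ℂ] H} (N : Submodule ℂ H)
    [N.HasOrthogonalProjection] :
    Commute N.starProjection X ↔ (∀ v ∈ N, X v ∈ N) ∧ ∀ v ∈ Nᗮ, X v ∈ Nᗮ := by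
  rw [N.isIdempotentElem_starProjection.commute_iff, Submodule.range_starProjection,
    Submodule.ker_starProjection]
  rfl

variable [CompleteSpace H] {C : H →ₗ⋆[ℂ] H}

lemma commute_starProjection_of_mapsTo {X : H →L[ℂ] H} (N : Submodule ℂ H)
    [N.HasOrthogonalProjection] (hX : ∀ v ∈ N, X v ∈ N) (hX' : ∀ v ∈ N, adjoint X v ∈ N) :
    Commute N.starProjection X :=
  (commute_starProjection_iff N).2 ⟨hX, orthogonal_mem_invtSubmodule hX'⟩

/-- The spectral projection of a self-adjoint operator `A` for the half-line `(-∞, 0]`. -/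
noncomputable def negativeProjection (A : H →L[ℂ] H) : H →L[ℂ] H :=
  (A⁺ : H →L[ℂ] H).ker.starProjection

lemma isStarProjection_negativeProjection (A : H →L[ℂ] H) :
    IsStarProjection (negativeProjection A) :=
  isStarProjection_starProjection

lemma isSelfAdjoint_posPart (A : H →L[ℂ] H) : IsSelfAdjoint A⁺ :=
  (CFC.posPart_nonneg A).isSelfAdjoint

lemma negativeProjection_mem_realAlgebra (hC : IsConjugation C) {A : H →L[ℂ] H}
    (hA : A ∈ hC.realAlgebra) : negativeProjection A ∈ hC.realAlgebra := by
  have hpos : A⁺ ∈ hC.realAlgebra := by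
    have := hC.isClosed_realAlgebra
    rw [CFC.posPart_def]
    exact cfcₙ_mem _ hA
  refine hC.starProjection_mem_realAlgebra _ fun v hv => LinearMap.mem_ker.2 ?_
  exact (hpos v).symm.trans ((congrArg C hv).trans (map_zero C))

lemma commute_negativeProjection {A X : H →L[ℂ] H} (h : Commute A X) :
    Commute (negativeProjection A) X := by
  have hpos : Commute A⁺ X := by
    rw [CFC.posPart_def]
    exact h.cfcₙ_real _
  have hpos' : Commute A⁺ (adjoint X) := by
    simpa only [(isSelfAdjoint_posPart A).star_eq, star_eq_adjoint] using hpos.star_star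
  have hker {Y : H →L[ℂ] H} (hY : Commute A⁺ Y) (v : H) (hv : v ∈ (A⁺ : H →L[ℂ] H).ker) :
      Y v ∈ (A⁺ : H →L[ℂ] H).ker :=
    (DFunLike.congr_fun hY.eq v).trans ((congrArg Y hv).trans (map_zero Y))
  exact commute_starProjection_of_mapsTo _ (hker hpos) (hker hpos')

lemma negativeProjection_mul_posPart (A : H →L[ℂ] H) : negativeProjection A * A⁺ = 0 := by
  have h : A⁺ * negativeProjection A = 0 :=
    ext fun v => LinearMap.mem_ker.1 (Submodule.starProjection_apply_mem (A⁺ : H →L[ℂ] H).ker v)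
  simpa only [star_mul, (isSelfAdjoint_posPart A).star_eq,
    (isStarProjection_negativeProjection A).isSelfAdjoint.star_eq, star_zero] using congrArg star h

lemma negativeProjection_mul_negPart (A : H →L[ℂ] H) : negativeProjection A * A⁻ = A⁻ :=
  ext fun v => Submodule.starProjection_eq_self_iff.2
    (DFunLike.congr_fun (CFC.posPart_mul_negPart A) v)

lemma norm_abs_sub_algebraMap_le {A : H →L[ℂ] H} (hA : IsSelfAdjoint A) {r : ℝ} (hr : ‖A‖ ≤ r) :
    ‖CFC.abs A - algebraMap ℝ (H →L[ℂ] H) (r / 2)‖ ≤ r / 2 := by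
  have hr0 : 0 ≤ r := (norm_nonneg A).trans hr
  rw [CFC.abs_eq_cfc_norm A hA, ← cfc_const (r / 2) A hA, ← cfc_sub ..]
  refine norm_cfc_le (by positivity) fun x hx => ?_
  have hx : ‖x‖ ≤ r :=
    calc ‖x‖ ≤ ‖A‖ * ‖(1 : H →L[ℂ] H)‖ := spectrum.norm_le_norm_mul_of_mem hx
      _ ≤ ‖A‖ := mul_le_of_le_one_right (norm_nonneg A) norm_id_le
      _ ≤ r := hr
  rw [Real.norm_eq_abs, abs_le]
  constructor <;> linarith [norm_nonneg x]

lemma norm_sub_negativeProjection_le {A : H →L[ℂ] H} (hA : IsSelfAdjoint A) {r : ℝ}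
    (hr : ‖A‖ ≤ r) :
    ‖A - ((-(r / 2)) • negativeProjection A + (r / 2) • (1 - negativeProjection A))‖ ≤ r / 2 := by
  set F := negativeProjection A
  have hu : 1 - 2 * F ∈ unitary (H →L[ℂ] H) := by
    have h := (isStarProjection_negativeProjection A).one_sub.two_mul_sub_one_mem_unitary
    rwa [mul_sub, mul_one, sub_right_comm, ← one_add_one_eq_two, add_sub_cancel_right,
      one_add_one_eq_two] at h
  have hpolar : (1 - 2 * F) * CFC.abs A = A := by
    rw [← CFC.posPart_add_negPart A hA, sub_mul, one_mul, mul_assoc, mul_add,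
      negativeProjection_mul_posPart, negativeProjection_mul_negPart, zero_add]
    conv_rhs => rw [← CFC.posPart_sub_negPart A hA]
    noncomm_ring
  have hfactor : A - ((-(r / 2)) • F + (r / 2) • (1 - F)) =
      (1 - 2 * F) * (CFC.abs A - algebraMap ℝ _ (r / 2)) := by
    rw [mul_sub, hpolar, Algebra.algebraMap_eq_smul_one, mul_smul_comm, mul_one, two_mul]
    module
  rw [hfactor, CStarRing.norm_mem_unitary_mul _ hu]
  exact norm_abs_sub_algebraMap_le hA hr

/-- A finite resolution of the identity into real spectral projections of `A`; that `E k`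
is a spectral projection of `A` is encoded by its lying in the double commutant of `A`. -/
structure IsRealResolution (hC : IsConjugation C) (A : H →L[ℂ] H) {ι : Type*} [Fintype ι]
    (E : ι → H →L[ℂ] H) : Prop extends CompleteOrthogonalIdempotents E where
  isSelfAdjoint : ∀ k, IsSelfAdjoint (E k)
  mem_realAlgebra : ∀ k, E k ∈ hC.realAlgebra
  commute : ∀ k X, Commute A X → Commute (E k) X

namespace IsRealResolution

variable {hC : IsConjugation C} {A : H →L[ℂ] H} {ι κ : Type*} [Fintype ι] [Fintype κ]
  {E : ι → H →L[ℂ] H} {F : κ → H →L[ℂ] H}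

lemma isSelfAdjoint_sum_smul (hE : IsRealResolution hC A E) (t : ι → ℝ) :
    IsSelfAdjoint (∑ k, t k • E k) :=
  isSelfAdjoint_sum _ fun k _ => (IsSelfAdjoint.all (t k)).smul (hE.isSelfAdjoint k)

lemma sum_smul_mem_realAlgebra (hE : IsRealResolution hC A E) (t : ι → ℝ) :
    ∑ k, t k • E k ∈ hC.realAlgebra :=
  sum_mem fun k _ => SMulMemClass.smul_mem (t k) (hE.mem_realAlgebra k)

lemma commute_sum_smul (hE : IsRealResolution hC A E) (t : ι → ℝ) {X : H →L[ℂ] H}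
    (h : Commute A X) : Commute (∑ k, t k • E k) X :=
  Commute.sum_left _ _ _ fun k _ => (hE.commute k X h).smul_left (t k)

lemma mul (hE : IsRealResolution hC A E) {t : ι → ℝ}
    (hF : IsRealResolution hC (A - ∑ k, t k • E k) F) :
    IsRealResolution hC A fun p : ι × κ => E p.1 * F p.2 := by
  have hFA l X (h : Commute A X) : Commute (F l) X :=
    hF.commute l X (h.sub_left (hE.commute_sum_smul t h))
  have hEF k l : Commute (E k) (F l) := hE.commute k _ (hFA l A (Commute.refl A)).symm
  exact
    { completeOrthogonalIdempotents_mul hE.toCompleteOrthogonalIdempotents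
        hF.toCompleteOrthogonalIdempotents hEF with
      isSelfAdjoint := fun p =>
        ((hE.isSelfAdjoint p.1).commute_iff (hF.isSelfAdjoint p.2)).1 (hEF p.1 p.2)
      mem_realAlgebra := fun p => mul_mem (hE.mem_realAlgebra p.1) (hF.mem_realAlgebra p.2)
      commute := fun p X h => (hE.commute p.1 X h).mul_left (hFA p.2 X h) }

end IsRealResolution

lemma isRealResolution_negativeProjection (hC : IsConjugation C) {A : H →L[ℂ] H}
    (hA : A ∈ hC.realAlgebra) :
    IsRealResolution hC A ![negativeProjection A, 1 - negativeProjection A] := by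
  have hF := isStarProjection_negativeProjection A
  have hFC := negativeProjection_mem_realAlgebra hC hA
  exact
    { CompleteOrthogonalIdempotents.of_isIdempotentElem hF.isIdempotentElem with
      isSelfAdjoint := Fin.forall_fin_two.2 ⟨hF.isSelfAdjoint, hF.one_sub.isSelfAdjoint⟩
      mem_realAlgebra := Fin.forall_fin_two.2 ⟨hFC, sub_mem (one_mem _) hFC⟩
      commute := Fin.forall_fin_two.2 ⟨fun X h => commute_negativeProjection h,
        fun X h => (Commute.one_left X).sub_left (commute_negativeProjection h)⟩ }

lemma exists_isRealResolution_norm_sub_le_div_pow (hC : IsConjugation C) {A : H →L[ℂ] H}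
    (hA : IsSelfAdjoint A) (hAC : A ∈ hC.realAlgebra) (n : ℕ) :
    ∃ (ι : Type) (_ : Fintype ι) (E : ι → H →L[ℂ] H) (t : ι → ℝ),
      IsRealResolution hC A E ∧ ‖A - ∑ k, t k • E k‖ ≤ ‖A‖ / 2 ^ n := by
  induction n with
  | zero =>
    refine ⟨Unit, inferInstance, fun _ => 1, fun _ => 0,
      { CompleteOrthogonalIdempotents.unique_iff.2 rfl with
        isSelfAdjoint := fun _ => IsSelfAdjoint.one _
        mem_realAlgebra := fun _ => one_mem _
        commute := fun _ X _ => Commute.one_left X }, ?_⟩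
    simp only [zero_smul, Finset.sum_const_zero, sub_zero, pow_zero, div_one, le_refl]
  | succ n ih =>
    -- Splitting the remainder `A₁` by its sign halves its norm.
    obtain ⟨ι, _, E, t, hE, hn⟩ := ih
    set A₁ := A - ∑ k, t k • E k with hA₁
    set r := ‖A‖ / 2 ^ n
    have hF := isRealResolution_negativeProjection hC
      (sub_mem hAC (hE.sum_smul_mem_realAlgebra t) : A₁ ∈ hC.realAlgebra)
    refine ⟨ι × Fin 2, inferInstance, _, fun p => t p.1 + ![-(r / 2), r / 2] p.2, hE.mul hF, ?_⟩
    rw [sum_add_smul_mul hE.toCompleteOrthogonalIdempotents hF.toCompleteOrthogonalIdempotents,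
      ← sub_sub, ← hA₁, Fin.sum_univ_two, pow_succ, ← div_div]
    exact norm_sub_negativeProjection_le (hA.sub (hE.isSelfAdjoint_sum_smul t)) hn

lemma exists_isRealResolution_norm_sub_lt (hC : IsConjugation C) {A : H →L[ℂ] H}
    (hA : IsSelfAdjoint A) (hAC : A ∈ hC.realAlgebra) {δ : ℝ} (hδ : 0 < δ) :
    ∃ (ι : Type) (_ : Fintype ι) (E : ι → H →L[ℂ] H) (t : ι → ℝ),
      IsRealResolution hC A E ∧ ‖A - ∑ k, t k • E k‖ < δ := by
  have hlim : Filter.Tendsto (fun n : ℕ => ‖A‖ / 2 ^ n) Filter.atTop (nhds 0) :=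
    tendsto_const_nhds.div_atTop (tendsto_pow_atTop_atTop_of_one_lt one_lt_two)
  obtain ⟨n, hn⟩ := (hlim.eventually_lt_const hδ).exists
  obtain ⟨ι, _, E, t, hE, hnorm⟩ := exists_isRealResolution_norm_sub_le_div_pow hC hA hAC n
  exact ⟨ι, _, E, t, hE, hnorm.trans_lt hn⟩

end Spectral

section Injective

lemma exists_injective_forall_mem {ι α : Type*} [Finite ι] {U : ι → Set α}
    (hU : ∀ k, (U k).Infinite) : ∃ f : ι → α, Function.Injective f ∧ ∀ k, f k ∈ U k := by
  classical
  have := Fintype.ofFinite ι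
  choose t htU ht using fun k => (hU k).exists_subset_card_eq (Fintype.card ι)
  obtain ⟨f, hf, hft⟩ := (Finset.all_card_le_biUnion_card_iff_exists_injective t).1 fun s => by
    rcases s.eq_empty_or_nonempty with rfl | ⟨k, hk⟩
    · exact zero_le
    · calc s.card ≤ Fintype.card ι := s.card_le_univ
        _ = (t k).card := (ht k).symm
        _ ≤ (s.biUnion t).card := Finset.card_le_card (Finset.subset_biUnion_of_mem t hk)
  exact ⟨f, hf, fun k => htU k (hft k)⟩

lemma dense_injective_forall_notMem {ι α : Type*} [Finite ι] [TopologicalSpace α] [T1Space α]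
    [∀ x : α, (nhdsWithin x {x}ᶜ).NeBot] {S : Set α} (hS : S.Finite) :
    Dense {t : ι → α | Function.Injective t ∧ ∀ k, t k ∉ S} := by
  intro t
  rw [mem_closure_iff_nhds]
  intro V hV
  rw [nhds_pi, Filter.mem_pi'] at hV
  obtain ⟨I, U, hU, hUV⟩ := hV
  have hinf k : (U k \ S).Infinite := (infinite_of_mem_nhds (t k) (hU k)).sdiff hS
  obtain ⟨f, hf, hfU⟩ := exists_injective_forall_mem hinf
  exact ⟨f, hUV fun k _ => (hfU k).1, hf, fun k => (hfU k).2⟩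

end Injective

section CornerPerturbation

open ContinuousLinearMap

/-- The perturbation which agrees with `D` on `N` and vanishes on the vectors `v` orthogonal to `N`
with `D v` orthogonal to `N`: in block form, `D` with its `(Nᗮ, Nᗮ)` corner removed. -/
noncomputable def cornerPerturbation (N : Submodule ℂ H) [N.HasOrthogonalProjection]
    (D : H →L[ℂ] H) : H →L[ℂ] H :=
  D - Nᗮ.starProjection * D * Nᗮ.starProjection

variable (N : Submodule ℂ H)

lemma cornerPerturbation_apply_of_mem [N.HasOrthogonalProjection] (D : H →L[ℂ] H) {v : H}
    (hv : v ∈ N) :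
    cornerPerturbation N D v = D v := by
  have h : Nᗮ.starProjection v = 0 := by
    rwa [Submodule.starProjection_apply_eq_zero_iff, Submodule.orthogonal_orthogonal]
  simp only [cornerPerturbation, sub_apply, mul_apply_eq_comp, h, map_zero, sub_zero]

lemma cornerPerturbation_apply_of_mem_orthogonal [N.HasOrthogonalProjection] (D : H →L[ℂ] H)
    {v : H} (hv : v ∈ Nᗮ) (hDv : D v ∈ Nᗮ) : cornerPerturbation N D v = 0 := by
  simp only [cornerPerturbation, sub_apply, mul_apply_eq_comp,
    Submodule.starProjection_eq_self_iff.2 hv, Submodule.starProjection_eq_self_iff.2 hDv, sub_self]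

lemma norm_cornerPerturbation_le [N.HasOrthogonalProjection] (D : H →L[ℂ] H) :
    ‖cornerPerturbation N D‖ ≤ 2 * ‖D‖ := by
  have h : ‖Nᗮ.starProjection * D * Nᗮ.starProjection‖ ≤ ‖D‖ :=
    calc _ ≤ ‖Nᗮ.starProjection‖ * ‖D‖ * ‖Nᗮ.starProjection‖ := norm_mul₃_le
      _ ≤ 1 * ‖D‖ * 1 := by
        gcongr <;> exact Nᗮ.starProjection_norm_le
      _ = ‖D‖ := by rw [one_mul, mul_one]
  calc _ ≤ ‖D‖ + ‖Nᗮ.starProjection * D * Nᗮ.starProjection‖ := norm_sub_le _ _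
    _ ≤ 2 * ‖D‖ := by linarith

lemma isCompactOperator_starProjection [FiniteDimensional ℂ N] :
    IsCompactOperator N.starProjection :=
  have : ProperSpace N := FiniteDimensional.proper ℂ N
  (isCompactOperator_of_locallyCompactSpace_dom N.orthogonalProjectionOnto).clm_comp N.subtypeL

lemma isCompactOperator_cornerPerturbation [FiniteDimensional ℂ N] (D : H →L[ℂ] H) :
    IsCompactOperator (cornerPerturbation N D) := by
  have hN := isCompactOperator_starProjection N
  have h : cornerPerturbation N D =
      N.starProjection * D + (Nᗮ.starProjection * D) * N.starProjection := by
    rw [cornerPerturbation, Submodule.starProjection_orthogonal']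
    noncomm_ring
  rw [h]
  exact (hN.comp_clm D).add (hN.clm_comp (Nᗮ.starProjection * D))

variable [CompleteSpace H]

lemma isSelfAdjoint_cornerPerturbation [N.HasOrthogonalProjection] {D : H →L[ℂ] H}
    (hD : IsSelfAdjoint D) :
    IsSelfAdjoint (cornerPerturbation N D) :=
  hD.sub (hD.conjugate_self (isSelfAdjoint_starProjection Nᗮ))

lemma cornerPerturbation_mem_realAlgebra [N.HasOrthogonalProjection] {C : H →ₗ⋆[ℂ] H}
    (hC : IsConjugation C) (hN : ∀ v ∈ N, C v ∈ N) {D : H →L[ℂ] H} (hD : D ∈ hC.realAlgebra) :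
    cornerPerturbation N D ∈ hC.realAlgebra := by
  have h : Nᗮ.starProjection ∈ hC.realAlgebra := by
    rw [Submodule.starProjection_orthogonal']
    exact sub_mem (one_mem _) (hC.starProjection_mem_realAlgebra N hN)
  exact sub_mem hD (mul_mem (mul_mem h hD) h)

end CornerPerturbation

section Eigensystem

variable [CompleteSpace H] {C : H →ₗ⋆[ℂ] H}

lemma inner_eq_zero_of_eigenvalue_ne {A : H →L[ℂ] H} (hA : IsSelfAdjoint A) {u v : H} {t r : ℝ}
    (hu : A u = t • u) (hv : A v = r • v) (htr : t ≠ r) : ⟪u, v⟫_ℂ = 0 := by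
  have h : ⟪A u, v⟫_ℂ = ⟪u, A v⟫_ℂ := hA.isSymmetric u v
  rw [hu, hv, inner_smul_left_eq_smul, inner_smul_right_eq_smul, ← sub_eq_zero,
    ← sub_smul] at h
  exact (smul_eq_zero.1 h).resolve_left (sub_ne_zero.2 htr)

/-- The operator `A` is a real self-adjoint operator and `s` is a set of real eigenvectors of `A`
belonging to pairwise distinct eigenvalues. -/
structure IsRealEigensystem (hC : IsConjugation C) (A : H →L[ℂ] H) (s : Set H) : Prop where
  isSelfAdjoint : IsSelfAdjoint A
  mem_realAlgebra : A ∈ hC.realAlgebra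
  ne_zero : ∀ y ∈ s, y ≠ 0
  map_eq : ∀ y ∈ s, C y = y
  exists_eigenvalue : ∀ y ∈ s, ∃ t : ℝ, A y = t • y
  eq_of_eigenvalue_eq : ∀ y ∈ s, ∀ z ∈ s, ∀ t : ℝ, A y = t • y → A z = t • z → y = z

namespace IsRealEigensystem

variable {hC : IsConjugation C} {A : H →L[ℂ] H} {s : Set H}

lemma inner_eq_zero (h : IsRealEigensystem hC A s) {y z u : H} (hy : y ∈ s) (hz : z ∈ s)
    (hyz : y ≠ z) {t : ℝ} (hyt : A y = t • y) (hut : A u = t • u) : ⟪u, z⟫_ℂ = 0 := by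
  obtain ⟨r, hr⟩ := h.exists_eigenvalue z hz
  refine inner_eq_zero_of_eigenvalue_ne h.isSelfAdjoint hut hr fun htr => hyz ?_
  exact h.eq_of_eigenvalue_eq y hy z hz t hyt (htr ▸ hr)

lemma pairwise_inner_eq_zero (h : IsRealEigensystem hC A s) {y z : H} (hy : y ∈ s) (hz : z ∈ s)
    (hyz : y ≠ z) : ⟪y, z⟫_ℂ = 0 := by
  obtain ⟨t, ht⟩ := h.exists_eigenvalue y hy
  exact h.inner_eq_zero hy hz hyz ht ht

lemma iUnion_of_tendsto {A : ℕ → H →L[ℂ] H} {s : ℕ → Set H} {A' : H →L[ℂ] H}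
    (h : ∀ n, IsRealEigensystem hC (A n) (s n)) (hs : ∀ n, s n ⊆ s (n + 1))
    (heq : ∀ n, Set.EqOn (A (n + 1)) (A n) (s n))
    (hlim : Filter.Tendsto A Filter.atTop (nhds A')) : IsRealEigensystem hC A' (⋃ n, s n) := by
  have hmono : Monotone s := monotone_nat_of_le_succ hs
  have heq' {m n} (hmn : m ≤ n) : Set.EqOn (A n) (A m) (s m) := by
    induction n, hmn using Nat.le_induction with
    | base => exact Set.eqOn_refl _ _
    | succ n hmn ih => exact ((heq n).mono (hmono hmn)).trans ih
  have hA' n : Set.EqOn A' (A n) (s n) := fun y hy =>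
    tendsto_nhds_unique (((continuous_eval_const y).tendsto A').comp hlim)
      (tendsto_atTop_of_eventually_const fun m (hm : m ≥ n) => heq' hm hy)
  refine
    { isSelfAdjoint := ?_
      mem_realAlgebra := hC.isClosed_realAlgebra.mem_of_tendsto hlim
        (.of_forall fun n => (h n).mem_realAlgebra)
      ne_zero := fun y hy => ?_
      map_eq := fun y hy => ?_
      exists_eigenvalue := fun y hy => ?_
      eq_of_eigenvalue_eq := fun y hy z hz t hyt hzt => ?_ }
  · exact (isClosed_eq continuous_star continuous_id).mem_of_tendsto hlim
      (.of_forall fun n => (h n).isSelfAdjoint)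
  · obtain ⟨n, hn⟩ := Set.mem_iUnion.1 hy
    exact (h n).ne_zero y hn
  · obtain ⟨n, hn⟩ := Set.mem_iUnion.1 hy
    exact (h n).map_eq y hn
  · obtain ⟨n, hn⟩ := Set.mem_iUnion.1 hy
    simpa only [hA' n hn] using (h n).exists_eigenvalue y hn
  · obtain ⟨m, hm⟩ := Set.mem_iUnion.1 hy
    obtain ⟨n, hn⟩ := Set.mem_iUnion.1 hz
    have hy' := hmono (le_max_left m n) hm
    have hz' := hmono (le_max_right m n) hn
    exact (h (max m n)).eq_of_eigenvalue_eq y hy' z hz' t (hA' _ hy' ▸ hyt) (hA' _ hz' ▸ hzt)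

end IsRealEigensystem

end Eigensystem

section Extension

variable [CompleteSpace H] {C : H →ₗ⋆[ℂ] H} {hC : IsConjugation C} {A : H →L[ℂ] H} {s : Set H}

open ContinuousLinearMap

lemma exists_isRealResolution_injective (hC : IsConjugation C) (hA : IsSelfAdjoint A)
    (hAC : A ∈ hC.realAlgebra) {S : Set ℝ} (hS : S.Finite) {δ : ℝ} (hδ : 0 < δ) :
    ∃ (ι : Type) (_ : Fintype ι) (E : ι → H →L[ℂ] H) (t : ι → ℝ), IsRealResolution hC A E ∧
      Function.Injective t ∧ (∀ k, t k ∉ S) ∧ ‖A - ∑ k, t k • E k‖ < δ := by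
  obtain ⟨ι, _, E, t₀, hE, ht₀⟩ := exists_isRealResolution_norm_sub_lt hC hA hAC hδ
  have hopen : IsOpen {t : ι → ℝ | ‖A - ∑ k, t k • E k‖ < δ} :=
    isOpen_lt (by fun_prop) continuous_const
  obtain ⟨t, ht, hinj, htS⟩ :=
    (dense_injective_forall_notMem hS).inter_open_nonempty _ hopen ⟨t₀, ht₀⟩
  exact ⟨ι, _, E, t, hE, hinj, htS, ht⟩

namespace IsRealEigensystem

lemma commute_starProjection_span (h : IsRealEigensystem hC A s)
    [(Submodule.span ℂ s).HasOrthogonalProjection] :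
    Commute (Submodule.span ℂ s).starProjection A := by
  have hmaps : Submodule.span ℂ s ≤ (Submodule.span ℂ s).comap (A : H →ₗ[ℂ] H) := by
    refine Submodule.span_le.2 fun y hy => ?_
    obtain ⟨t, ht⟩ := h.exists_eigenvalue y hy
    have hty : t • y ∈ Submodule.span ℂ s :=
      Submodule.smul_of_tower_mem _ t (Submodule.subset_span hy)
    rwa [← ht] at hty
  refine commute_starProjection_of_mapsTo _ hmaps ?_
  rw [← star_eq_adjoint, h.isSelfAdjoint.star_eq]
  exact hmaps

lemma union {ι : Type*} (h : IsRealEigensystem hC A s) {A' : H →L[ℂ] H} (hA' : IsSelfAdjoint A')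
    (hA'C : A' ∈ hC.realAlgebra) (heq : Set.EqOn A' A s) {y : ι → H} {t : ι → ℝ}
    (hy : ∀ k, C (y k) = y k) (hyt : ∀ k, A' (y k) = t k • y k) (ht : Function.Injective t)
    (hts : ∀ k, ∀ v ∈ s, A v ≠ t k • v) :
    IsRealEigensystem hC A' (s ∪ Set.range y \ {0}) where
  isSelfAdjoint := hA'
  mem_realAlgebra := hA'C
  ne_zero := by
    rintro v (hv | ⟨-, hv⟩)
    exacts [h.ne_zero v hv, hv]
  map_eq := by
    rintro v (hv | ⟨⟨k, rfl⟩, -⟩)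
    exacts [h.map_eq v hv, hy k]
  exists_eigenvalue := by
    rintro v (hv | ⟨⟨k, rfl⟩, -⟩)
    · exact heq hv ▸ h.exists_eigenvalue v hv
    · exact ⟨t k, hyt k⟩
  eq_of_eigenvalue_eq := by
    have heigen {k r} (hk : y k ≠ 0) (hr : A' (y k) = r • y k) : r = t k :=
      smul_left_injective ℝ hk (hr.symm.trans (hyt k))
    rintro v (hv | ⟨⟨k, rfl⟩, hk⟩) w (hw | ⟨⟨l, rfl⟩, hl⟩) r hvr hwr
    · exact h.eq_of_eigenvalue_eq v hv w hw r (heq hv ▸ hvr) (heq hw ▸ hwr)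
    · exact absurd (heq hv ▸ hvr) (heigen hl hwr ▸ hts l v hv)
    · exact absurd (heq hw ▸ hwr) (heigen hk hvr ▸ hts k w hw)
    · rw [ht ((heigen hk hvr).symm.trans (heigen hl hwr))]

lemma exists_extension_of_resolution {ι : Type*} [Fintype ι] {E : ι → H →L[ℂ] H} {t : ι → ℝ}
    (h : IsRealEigensystem hC A s) [(Submodule.span ℂ s).HasOrthogonalProjection]
    (hE : IsRealResolution hC A E) (ht : Function.Injective t)
    (hts : ∀ k, ∀ v ∈ s, A v ≠ t k • v) {z : H} (hz : z ∈ (Submodule.span ℂ s)ᗮ) (hCz : C z = z) :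
    ∃ A' : H →L[ℂ] H, IsRealEigensystem hC A' (s ∪ (Set.range fun k => E k z) \ {0}) ∧
      Set.EqOn A' A s ∧ IsCompactOperator (A' - A) ∧ ‖A' - A‖ ≤ 2 * ‖A - ∑ k, t k • E k‖ := by
  set y : ι → H := fun k => E k z
  set Q := ∑ k, t k • E k
  set N := Submodule.span ℂ (Set.range y)
  have := FiniteDimensional.span_of_finite ℂ (Set.finite_range y)
  have hPA := h.commute_starProjection_span
  have hy k : C (y k) = y k := (hE.mem_realAlgebra k z).trans (by rw [hCz])
  have hyN k : y k ∈ N := Submodule.subset_span ⟨k, rfl⟩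
  have hNs : N ≤ (Submodule.span ℂ s)ᗮ := Submodule.span_le.2 <| by
    rintro _ ⟨k, rfl⟩
    exact ((commute_starProjection_iff _).1 (hE.commute k _ hPA.symm).symm).2 z hz
  have hsN : Submodule.span ℂ s ≤ Nᗮ := Submodule.le_orthogonal_iff_le_orthogonal.1 hNs
  have hNC : ∀ v ∈ N, C v ∈ N := fun v => map_mem_span_of_map_eq (Set.forall_mem_range.2 hy)
  have hQA : Commute (Submodule.span ℂ s).starProjection (Q - A) :=
    (hE.commute_sum_smul t hPA.symm).symm.sub_right hPA
  have heq : Set.EqOn (A + cornerPerturbation N (Q - A)) A s := fun v hv => by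
    have hvs := Submodule.subset_span (R := ℂ) hv
    rw [add_apply, cornerPerturbation_apply_of_mem_orthogonal N _ (hsN hvs)
      (hsN (((commute_starProjection_iff _).1 hQA).1 v hvs)), add_zero]
  have heigen k : (A + cornerPerturbation N (Q - A)) (y k) = t k • y k := by
    rw [add_apply, cornerPerturbation_apply_of_mem N _ (hyN k), sub_apply, add_sub_cancel]
    exact DFunLike.congr_fun
      (sum_smul_mul_of_orthogonalIdempotents hE.toOrthogonalIdempotents t k) z
  refine ⟨A + cornerPerturbation N (Q - A), h.union ?_ ?_ heq hy heigen ht hts, heq, ?_, ?_⟩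
  · exact h.isSelfAdjoint.add (isSelfAdjoint_cornerPerturbation N
      ((hE.isSelfAdjoint_sum_smul t).sub h.isSelfAdjoint))
  · exact add_mem h.mem_realAlgebra (cornerPerturbation_mem_realAlgebra N hC hNC
      (sub_mem (hE.sum_smul_mem_realAlgebra t) h.mem_realAlgebra))
  · rw [add_sub_cancel_left]
    exact isCompactOperator_cornerPerturbation N (Q - A)
  · rw [add_sub_cancel_left, norm_sub_rev A Q]
    exact norm_cornerPerturbation_le N (Q - A)

lemma exists_extension_mem_span (h : IsRealEigensystem hC A s) (hs : s.Finite) {x : H}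
    (hx : C x = x) {δ : ℝ} (hδ : 0 < δ) :
    ∃ (A' : H →L[ℂ] H) (s' : Set H), IsRealEigensystem hC A' s' ∧ s'.Finite ∧ s ⊆ s' ∧
      Set.EqOn A' A s ∧ x ∈ Submodule.span ℂ s' ∧ IsCompactOperator (A' - A) ∧ ‖A' - A‖ ≤ δ := by
  have := FiniteDimensional.span_of_finite ℂ hs
  choose! r hr using h.exists_eigenvalue
  obtain ⟨ι, _, E, t, hE, ht, htr, hnorm⟩ := exists_isRealResolution_injective hC h.isSelfAdjoint
    h.mem_realAlgebra (hs.image r) (half_pos hδ)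
  have hts k v (hv : v ∈ s) : A v ≠ t k • v := fun htv => htr k
    ⟨v, hv, smul_left_injective ℝ (h.ne_zero v hv) ((hr v hv).symm.trans htv)⟩
  set P := (Submodule.span ℂ s).starProjection
  have hP : P ∈ hC.realAlgebra :=
    hC.starProjection_mem_realAlgebra _ fun v => map_mem_span_of_map_eq h.map_eq
  have hz : C (x - P x) = x - P x := by rw [map_sub, hP x, hx]
  obtain ⟨A', hA', heq, hcpt, hle⟩ := h.exists_extension_of_resolution hE ht hts
    (Submodule.sub_starProjection_mem_orthogonal x) hz
  refine ⟨A', _, hA', hs.union ((Set.finite_range _).sdiff), Set.subset_union_left, heq, ?_, hcpt,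
    hle.trans (by linarith)⟩
  have hsum : P x + ∑ k, E k (x - P x) = x := by
    rw [← sum_apply, hE.complete, one_apply_eq_self, add_sub_cancel]
  have hmem := Submodule.add_mem_sup (Submodule.starProjection_apply_mem (Submodule.span ℂ s) x)
    (sum_mem fun k _ => Submodule.subset_span ⟨k, rfl⟩ :
      ∑ k, E k (x - P x) ∈ Submodule.span ℂ (Set.range fun k => E k (x - P x)))
  rw [Submodule.span_union, Submodule.span_sdiff_singleton_zero]
  rwa [hsum] at hmem

end IsRealEigensystem

end Extension

section WeylVonNeumann

variable {C : H →ₗ⋆[ℂ] H}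

lemma IsConjugation.dense_of_forall_add_map_mem (hC : IsConjugation C) {α : Type*} {z : α → H}
    (hz : DenseRange z) {M : Submodule ℂ H} (hM : ∀ n, z n + C (z n) ∈ M) : Dense (M : Set H) := by
  have hadd v : v + C v ∈ M.topologicalClosure :=
    hz.induction_on v
      (M.isClosed_topologicalClosure.preimage (continuous_id.add hC.continuous))
      fun n => M.le_topologicalClosure (hM n)
  rw [Submodule.dense_iff_topologicalClosure_eq_top, Submodule.eq_top_iff']
  intro v
  have hsub : v - C v ∈ M.topologicalClosure := by
    have h := Submodule.smul_mem _ (-Complex.I) (hadd (Complex.I • v))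
    rwa [map_smulₛₗ, Complex.conj_I, smul_add, smul_smul, smul_smul, neg_mul_neg, neg_mul,
      Complex.I_mul_I, neg_neg, one_smul, neg_one_smul, ← sub_eq_add_neg] at h
  have h2 := Submodule.smul_mem _ (2⁻¹ : ℂ) (add_mem (hadd v) hsub)
  rwa [add_add_sub_cancel, ← two_smul ℂ v, inv_smul_smul₀ two_ne_zero] at h2

variable [CompleteSpace H]

lemma isRealEigensystem_empty {hC : IsConjugation C} {A : H →L[ℂ] H} (hA : IsSelfAdjoint A)
    (hAC : A ∈ hC.realAlgebra) : IsRealEigensystem hC A ∅ where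
  isSelfAdjoint := hA
  mem_realAlgebra := hAC
  ne_zero _ := False.elim
  map_eq _ := False.elim
  exists_eigenvalue _ := False.elim
  eq_of_eigenvalue_eq _ := False.elim

lemma exists_seq_isRealEigensystem (hC : IsConjugation C) {A : H →L[ℂ] H} (hA : IsSelfAdjoint A)
    (hAC : A ∈ hC.realAlgebra) {x : ℕ → H} (hx : ∀ n, C (x n) = x n) {δ : ℕ → ℝ}
    (hδ : ∀ n, 0 < δ n) :
    ∃ (a : ℕ → H →L[ℂ] H) (s : ℕ → Set H), a 0 = A ∧ ∀ n, IsRealEigensystem hC (a n) (s n) ∧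
      (s n).Finite ∧ s n ⊆ s (n + 1) ∧ Set.EqOn (a (n + 1)) (a n) (s n) ∧
      x n ∈ Submodule.span ℂ (s (n + 1)) ∧ IsCompactOperator (a (n + 1) - a n) ∧
      ‖a (n + 1) - a n‖ ≤ δ n := by
  let System := {p : (H →L[ℂ] H) × Set H // IsRealEigensystem hC p.1 p.2 ∧ p.2.Finite}
  have hstep (n : ℕ) (p : System) : ∃ q : System, p.1.2 ⊆ q.1.2 ∧ Set.EqOn q.1.1 p.1.1 p.1.2 ∧
      x n ∈ Submodule.span ℂ q.1.2 ∧ IsCompactOperator (q.1.1 - p.1.1) ∧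
      ‖q.1.1 - p.1.1‖ ≤ δ n := by
    obtain ⟨A', s', hA', hs', h⟩ := p.2.1.exists_extension_mem_span p.2.2 (hx n) (hδ n)
    exact ⟨⟨(A', s'), hA', hs'⟩, h⟩
  choose next hnext using hstep
  let p : ℕ → System :=
    Nat.rec ⟨(A, ∅), isRealEigensystem_empty hA hAC, Set.finite_empty⟩ next
  exact ⟨fun n => (p n).1.1, fun n => (p n).1.2, rfl,
    fun n => ⟨(p n).2.1, (p n).2.2, hnext n (p n)⟩⟩

theorem exists_isRealEigensystem_dense_span [TopologicalSpace.SeparableSpace H]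
    (hC : IsConjugation C) {A : H →L[ℂ] H} (hA : IsSelfAdjoint A) (hAC : A ∈ hC.realAlgebra)
    {δ : ℝ} (hδ : 0 < δ) :
    ∃ (A' : H →L[ℂ] H) (s : Set H), IsRealEigensystem hC A' s ∧ s.Countable ∧
      Dense (Submodule.span ℂ s : Set H) ∧ IsCompactOperator (A' - A) ∧ ‖A' - A‖ ≤ δ := by
  set z := TopologicalSpace.denseSeq H
  have hz n : C (z n + C (z n)) = z n + C (z n) := by rw [map_add, hC.involutive, add_comm]
  obtain ⟨a, s, rfl, h⟩ :=
    exists_seq_isRealEigensystem hC hA hAC hz (δ := fun n => δ / 2 / 2 ^ n) fun n => by positivity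
  choose hsys hfin hs heq hzs hcpt hnorm using h
  have hdist n : dist (a n) (a (n + 1)) ≤ δ / 2 / 2 ^ n := by
    rw [dist_comm, dist_eq_norm]
    exact hnorm n
  obtain ⟨A', hA'⟩ := cauchySeq_tendsto_of_complete (cauchySeq_of_le_geometric_two hdist)
  refine ⟨A', ⋃ n, s n, .iUnion_of_tendsto hsys hs heq hA',
    Set.countable_iUnion fun n => (hfin n).countable, ?_, ?_, ?_⟩
  · refine hC.dense_of_forall_add_map_mem (TopologicalSpace.denseRange_denseSeq H) fun n => ?_
    exact Submodule.span_mono (Set.subset_iUnion s (n + 1)) (hzs n)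
  · have hcpt' n : IsCompactOperator (a n - a 0) := by
      induction n with
      | zero =>
        rw [sub_self]
        exact isCompactOperator_zero
      | succ n ih =>
        rw [← sub_add_sub_cancel _ (a n)]
        exact (hcpt n).add ih
    exact isCompactOperator_of_tendsto (hA'.sub_const (a 0)) (.of_forall hcpt')
  · rw [← dist_eq_norm, dist_comm]
    exact dist_le_of_le_geometric_two_of_tendsto₀ hdist hA'

end WeylVonNeumann

section Coupling

open ContinuousLinearMap InnerProductSpace

lemma isCompactOperator_rankOne (x y : H) : IsCompactOperator (rankOne ℂ x y) :=
  have hx : IsCompactOperator (toSpanSingleton ℂ x) :=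
    isCompactOperator_of_locallyCompactSpace_rng _
  hx.comp_clm (innerSL ℂ y)

lemma exists_smul_rankOne_forall_inner_ne_zero (B : H →L[ℂ] H) {s : Set H} (hs : s.Countable)
    {w : H} (hw : ∀ y ∈ s, ⟪y, w⟫_ℂ ≠ 0) {r : ℝ} (hr : 0 < r) :
    ∃ τ : ℝ, |τ| < r ∧ ∀ y ∈ s, ∀ z ∈ s, ⟪y, (B + τ • rankOne ℂ w w) z⟫_ℂ ≠ 0 := by
  let root (p : H × H) : ℝ := (-⟪p.1, B p.2⟫_ℂ / (⟪p.1, w⟫_ℂ * ⟪w, p.2⟫_ℂ)).re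
  have hroots : (root '' s ×ˢ s).Countable := (hs.prod hs).image root
  obtain ⟨τ, hτ, hτr⟩ := (hroots.dense_compl ℝ).exists_mem_open Metric.isOpen_ball
    ⟨0, Metric.mem_ball_self hr⟩
  refine ⟨τ, by simpa using hτr, fun y hy z hz h0 => hτ ⟨(y, z), ⟨hy, hz⟩, ?_⟩⟩
  have hwz : ⟪w, z⟫_ℂ ≠ 0 := inner_eq_zero_symm.not.1 (hw z hz)
  rw [add_apply, smul_apply, inner_add_right, inner_smul_right_eq_smul, inner_right_rankOne_apply,
    Complex.real_smul, add_comm, ← eq_neg_iff_add_eq_zero] at h0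
  change (-⟪y, B z⟫_ℂ / (⟪y, w⟫_ℂ * ⟪w, z⟫_ℂ)).re = τ
  rw [← h0, mul_div_cancel_right₀ _ (mul_ne_zero (hw y hy) hwz), Complex.ofReal_re]

variable [CompleteSpace H] {C : H →ₗ⋆[ℂ] H} {hC : IsConjugation C} {A B : H →L[ℂ] H} {s : Set H}

lemma IsRealEigensystem.exists_map_eq_forall_inner_ne_zero (h : IsRealEigensystem hC A s)
    (hs : s.Countable) : ∃ w, C w = w ∧ ∀ y ∈ s, ⟪y, w⟫_ℂ ≠ 0 := by
  obtain ⟨ε, hε, c, hc, -⟩ := hs.exists_pos_hasSum_le one_pos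
  set f : s → H := fun y => (ε y / ‖(y : H)‖) • (y : H)
  have hnorm (y : s) : ‖f y‖ = ε y := by
    rw [norm_smul, Real.norm_of_nonneg (by have := hε y; positivity),
      div_mul_cancel₀ _ (norm_ne_zero_iff.2 (h.ne_zero y y.2))]
  obtain ⟨w, hw⟩ : Summable f := .of_norm (by simpa only [hnorm] using hc.summable)
  have hCf : C ∘ f = f := funext fun y =>
    (hC.map_real_smul _ _).trans (by rw [h.map_eq y y.2])
  refine ⟨w, (hCf ▸ hw.map C hC.continuous).unique hw, fun y hy => ?_⟩
  have hinner : HasSum (fun z => ⟪y, f z⟫_ℂ) ⟪y, w⟫_ℂ := (innerSL ℂ y).hasSum hw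
  have hsingle : HasSum (fun z => ⟪y, f z⟫_ℂ) ⟪y, f ⟨y, hy⟩⟫_ℂ :=
    hasSum_single _ fun z hz => by
      have hyz : y ≠ z := fun hyz => hz (Subtype.ext hyz.symm)
      rw [inner_smul_right_eq_smul, h.pairwise_inner_eq_zero hy z.2 hyz, smul_zero]
  rw [hinner.unique hsingle, inner_smul_right_eq_smul]
  have hy0 := h.ne_zero y hy
  exact smul_ne_zero (div_pos (hε y) (norm_pos_iff.2 hy0)).ne' (inner_self_ne_zero.2 hy0)

lemma IsRealEigensystem.exists_perturbation_forall_inner_ne_zero (h : IsRealEigensystem hC A s)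
    (hs : s.Countable) (hB : IsSelfAdjoint B) (hBC : B ∈ hC.realAlgebra) {δ : ℝ} (hδ : 0 < δ) :
    ∃ B' : H →L[ℂ] H, IsSelfAdjoint B' ∧ B' ∈ hC.realAlgebra ∧ IsCompactOperator (B' - B) ∧
      ‖B' - B‖ < δ ∧ ∀ y ∈ s, ∀ z ∈ s, ⟪y, B' z⟫_ℂ ≠ 0 := by
  obtain ⟨w, hCw, hw⟩ := h.exists_map_eq_forall_inner_ne_zero hs
  obtain ⟨τ, hτ, hne⟩ := exists_smul_rankOne_forall_inner_ne_zero B hs hw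
    (div_pos hδ (by positivity : 0 < ‖w‖ * ‖w‖ + 1))
  refine ⟨B + τ • rankOne ℂ w w, hB.add ((IsSelfAdjoint.all τ).smul ?_),
    add_mem hBC (SMulMemClass.smul_mem τ (hC.rankOne_mem_realAlgebra hCw)), ?_, ?_, hne⟩
  · exact isSelfAdjoint_iff'.2 (adjoint_rankOne w w)
  · rw [add_sub_cancel_left]
    exact (isCompactOperator_rankOne w w).smul τ
  · rw [add_sub_cancel_left, norm_smul, norm_rankOne, Real.norm_eq_abs]
    calc |τ| * (‖w‖ * ‖w‖) ≤ |τ| * (‖w‖ * ‖w‖ + 1) := by gcongr; linarith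
      _ < δ := (lt_div_iff₀ (by positivity)).1 hτ

end Coupling

section Irreducible

variable [CompleteSpace H] {C : H →ₗ⋆[ℂ] H} {hC : IsConjugation C} {A B D : H →L[ℂ] H} {s : Set H}

namespace IsRealEigensystem

lemma exists_apply_eq_smul_of_commute (h : IsRealEigensystem hC A s)
    (hs : Dense (Submodule.span ℂ s : Set H)) (hDA : Commute D A) {y : H} (hy : y ∈ s) :
    ∃ c : ℂ, D y = c • y := by
  obtain ⟨t, ht⟩ := h.exists_eigenvalue y hy
  have hDy : A (D y) = t • D y := by
    have hcomm : D (A y) = A (D y) := DFunLike.congr_fun hDA.eq y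
    rw [← hcomm, ht, D.map_smul_of_tower]
  set c : ℂ := conj (⟪D y, y⟫_ℂ / ⟪y, y⟫_ℂ)
  have hortho : ∀ z ∈ s, ⟪D y, z⟫_ℂ = ⟪c • y, z⟫_ℂ := by
    intro z hz
    rcases eq_or_ne y z with rfl | hyz
    · rw [inner_smul_left, Complex.conj_conj,
        div_mul_cancel₀ _ (inner_self_ne_zero.2 (h.ne_zero y hy))]
    · rw [h.inner_eq_zero hy hz hyz ht hDy, inner_smul_left, h.pairwise_inner_eq_zero hy hz hyz,
        mul_zero]
  have hinner : innerSL ℂ (D y) = innerSL ℂ (c • y) := ContinuousLinearMap.ext_on hs hortho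
  exact ⟨c, innerSL_inj.1 hinner⟩

lemma exists_eq_smul_one_of_commute (h : IsRealEigensystem hC A s)
    (hs : Dense (Submodule.span ℂ s : Set H)) (hB : ∀ y ∈ s, ∀ z ∈ s, ⟪y, B z⟫_ℂ ≠ 0)
    (hD : IsSelfAdjoint D) (hDA : Commute D A) (hDB : Commute D B) : ∃ c : ℂ, D = c • 1 := by
  choose! c hc using fun y (hy : y ∈ s) => h.exists_apply_eq_smul_of_commute hs hDA hy
  have hconj : ∀ y ∈ s, ∀ z ∈ s, conj (c y) = c z := by
    intro y hy z hz
    refine mul_right_cancel₀ (hB y hy z hz) ?_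
    calc conj (c y) * ⟪y, B z⟫_ℂ = ⟪D y, B z⟫_ℂ := by rw [hc y hy, inner_smul_left]
      _ = ⟪y, D (B z)⟫_ℂ := hD.isSymmetric y (B z)
      _ = ⟪y, B (D z)⟫_ℂ := congrArg (inner ℂ y) (DFunLike.congr_fun hDB.eq z)
      _ = c z * ⟪y, B z⟫_ℂ := by rw [hc z hz, map_smul, inner_smul_right]
  rcases s.eq_empty_or_nonempty with rfl | ⟨y, hy⟩
  · exact ⟨0, ContinuousLinearMap.ext_on hs (Set.eqOn_empty _ _)⟩
  · exact ⟨conj (c y), ContinuousLinearMap.ext_on hs fun z hz => by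
      rw [hc z hz, hconj y hy z hz, smul_apply, one_apply_eq_self]⟩

lemma isIrreducible_add_I_smul (h : IsRealEigensystem hC A s)
    (hs : Dense (Submodule.span ℂ s : Set H)) (hB : IsSelfAdjoint B)
    (hne : ∀ y ∈ s, ∀ z ∈ s, ⟪y, B z⟫_ℂ ≠ 0) : IsIrreducible (A + Complex.I • B) := by
  intro P hP hcomm
  obtain ⟨hPA, hPB⟩ := commute_of_commute_add_I_smul h.isSelfAdjoint hB hP.isSelfAdjoint hcomm
  obtain ⟨c, hc⟩ := h.exists_eq_smul_one_of_commute hs hne hP.isSelfAdjoint hPA hPB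
  have hcP : (c - 1) • P = 0 := by
    rw [sub_smul, one_smul, sub_eq_zero]
    calc c • P = c • 1 * P := (smul_one_mul c P).symm
      _ = P := by rw [← hc, hP.isIdempotentElem.eq]
  rcases smul_eq_zero.1 hcP with hc1 | hP0
  · exact .inr (by rw [hc, sub_eq_zero.1 hc1, one_smul])
  · exact .inl hP0

end IsRealEigensystem

end Irreducible

lemma separableSpace_of_hilbertBasis {ι : Type*} [Countable ι] (e : HilbertBasis ι ℂ H) :
    TopologicalSpace.SeparableSpace H := by
  have h := ((Set.countable_range e).isSeparable.span (R := ℂ)).closure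
  rw [← Submodule.topologicalClosure_coe, e.dense_span] at h
  exact TopologicalSpace.isSeparable_univ_iff.1 h

lemma IsWeightedShift.separableSpace {T : H →L[ℂ] H} (hT : IsWeightedShift T) :
    TopologicalSpace.SeparableSpace H := by
  rcases hT with ⟨e, -⟩ | ⟨e, -⟩
  all_goals exact separableSpace_of_hilbertBasis e

end CSO

open ComplexStarModule in
theorem proposition3p8_general {H : Type*} [NormedAddCommGroup H] [InnerProductSpace ℂ H]
    [CompleteSpace H] [TopologicalSpace.SeparableSpace H] (T : H →L[ℂ] H)
    (hT : CSO.IsComplexSymmetric T) (ε : ℝ) (hε : 0 < ε) :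
    ∃ K : H →L[ℂ] H, IsCompactOperator K ∧ ‖K‖ < ε ∧
      CSO.IsComplexSymmetric (T + K) ∧ CSO.IsIrreducible (T + K) := by
  obtain ⟨C, hC, hCT⟩ := hT
  obtain ⟨A, s, hA, hs, hdense, hAcpt, hAnorm⟩ := CSO.exists_isRealEigensystem_dense_span hC
    (ℜ T).2 (hC.realPart_mem_realAlgebra hCT) (half_pos hε)
  obtain ⟨B, hB, hBC, hBcpt, hBnorm, hne⟩ := hA.exists_perturbation_forall_inner_ne_zero hs
    (ℑ T).2 (hC.imaginaryPart_mem_realAlgebra hCT) (half_pos hε)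
  have hsum : T + ((A - ℜ T) + Complex.I • (B - ℑ T)) = A + Complex.I • B := by
    calc _ = (ℜ T + Complex.I • ℑ T) + ((A - ℜ T) + Complex.I • (B - ℑ T)) := by
          rw [realPart_add_I_smul_imaginaryPart]
      _ = A + Complex.I • B := by module
  refine ⟨(A - ℜ T) + Complex.I • (B - ℑ T), hAcpt.add (hBcpt.smul Complex.I), ?_, ?_, ?_⟩
  · calc _ ≤ ‖A - ℜ T‖ + ‖Complex.I • (B - ℑ T)‖ := norm_add_le _ _
      _ < ε / 2 + ε / 2 := by
        rw [norm_smul, Complex.norm_I, one_mul]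
        exact add_lt_add_of_le_of_lt hAnorm hBnorm
      _ = ε := add_halves ε
  · rw [hsum]
    exact ⟨C, hC, hC.map_add_I_smul_map hA.isSelfAdjoint hA.mem_realAlgebra hB hBC⟩
  · rw [hsum]
    exact hA.isIrreducible_add_I_smul hdense hB hne

theorem proposition3p8 {H : Type*} [NormedAddCommGroup H] [InnerProductSpace ℂ H]
    [CompleteSpace H] (T : H →L[ℂ] H) (hT : CSO.IsComplexSymmetric T)
    (hshift : CSO.IsWeightedShift T) (ε : ℝ) (hε : 0 < ε) :
    ∃ K : H →L[ℂ] H, IsCompactOperator K ∧ ‖K‖ < ε ∧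
      CSO.IsComplexSymmetric (T + K) ∧ CSO.IsIrreducible (T + K) := by
  have := hshift.separableSpace
  exact proposition3p8_general T hT ε hε
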